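/- Let $\Gamma$ be a countably infinite discrete group and let $\Delta\subset\Gamma$ be a finitely generated subgroup with a single end, i.e. such that the Cayley graph of $\Delta$ with respect to a finite generating set has exactly one end. Let $\mathbb{Z}\Gamma$ be the integral group ring of $\Gamma$, on which $\Delta$ acts by left multiplication. Then every $1$-cocycle $c\colon\Delta\to\mathbb{Z}\Gamma$, i.e. every map with $c(\delta\delta')=c(\delta)+\delta\, c(\delta')$ for all $\delta,\delta'\in\Delta$, is a coboundary: there exists $b\in\mathbb{Z}\Gamma$ such that $c(\delta)=b-\delta b$ for every $\delta\in\Delta$. -/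

import Mathlib

/-- A group `G` is finitely generated with a single end if, for some finite generating set `S`,
the space of ends of the Cayley graph of `G` with respect to `S` is a one-point space.
(The space of ends of the Cayley graph of a finitely generated group does not depend on the
finite generating set, up to bijection, so that `some` could be replaced by `every`.) -/
def HasSingleEnd (G : Type*) [Group G] : Prop :=
  ∃ S : Set G, S.Finite ∧ Subgroup.closure S = ⊤ ∧
    Nat.card (SimpleGraph.mulCayley S).end = 1

/-- Let `M` be a left `ℤΓ`-module and `Δ` a subgroup of `Γ`. A map `c : Δ → M` is a `1`-cocycle if
`c (γ γ') = c γ + γ c γ'` for all `γ, γ'` in `Δ`. -/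
def IsOneCocycle {Γ M : Type*} [Group Γ] [AddCommGroup M] [Module (MonoidAlgebra ℤ Γ) M]
    (Δ : Subgroup Γ) (c : Δ → M) : Prop :=
  ∀ γ γ' : Δ, c (γ * γ') = c γ + MonoidAlgebra.of ℤ Γ (γ : Γ) • c γ'

/-- Let `M` be a left `ℤΓ`-module and `Δ` a subgroup of `Γ`. A map `c : Δ → M` is a `1`-coboundary
if there is some `b` in `M` with `c γ = b - γ b` for all `γ` in `Δ`. -/
def IsOneCoboundary {Γ M : Type*} [Group Γ] [AddCommGroup M] [Module (MonoidAlgebra ℤ Γ) M]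
    (Δ : Subgroup Γ) (c : Δ → M) : Prop :=
  ∃ b : M, ∀ γ : Δ, c γ = b - MonoidAlgebra.of ℤ Γ (γ : Γ) • b

open Filter

namespace SimpleGraph

variable {V : Type*} {G : SimpleGraph V}

/-! If `c x = b - x b`, then `b g` must be the limit of `(c x) g` as `x` leaves finite subsets of
`Δ`. By the cocycle identity, `x ↦ (c x) g` changes under right multiplication by a generator at
only finitely many `x`, so with one end it is constant off a finite set, which supplies the limit.
Each coset `Δt` then meets the support of `b` in a finite set, and the finitely many values of `c`
on inverses of generators touch only finitely many cosets. -/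

/-- In a locally finite preconnected graph, every ultrafilter finer than the cofinite filter
contains the components of an end. -/
theorem exists_end_mem_ultrafilter [LocallyFinite G] (hG : G.Preconnected) (U : Ultrafilter V)
    (hU : (U : Filter V) ≤ cofinite) :
    ∃ e : G.end, ∀ K : Finset V, SetLike.coe (A := G.ComponentCompl K) (e.1 (.op K)) ∈ U := by
  have : Fact G.Preconnected := ⟨hG⟩
  have key (K : Finset V) : ∃ C : G.ComponentCompl K, (C : Set V) ∈ U := by
    have h : (⋃ C ∈ (Set.univ : Set (G.ComponentCompl K)), (C : Set V)) ∈ U := by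
      refine mem_of_superset (hU K.finite_toSet.compl_mem_cofinite) fun v hv => ?_
      exact Set.mem_biUnion (Set.mem_univ (G.componentComplMk hv)) (G.componentComplMk_mem hv)
    obtain ⟨C, -, hC⟩ := (Ultrafilter.finite_biUnion_mem_iff Set.finite_univ).1 h
    exact ⟨C, hC⟩
  choose C hC using key
  refine ⟨⟨fun K => C K.unop, ?_⟩, hC⟩
  -- Both components lie in `U`, so they meet; this makes the choices compatible.
  intro L K h
  refine (ComponentCompl.hom_eq_iff_not_disjoint _ (CategoryTheory.le_of_op_hom h) _).2 ?_
  rw [Set.not_disjoint_iff_nonempty_inter]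
  exact U.nonempty_of_mem (inter_mem (hC _) (hC _))

/-- In a locally finite preconnected graph with at most one end, a function on the vertices which
is locally constant outside a finite set is constant outside a finite set. -/
theorem exists_finite_ne_of_locally_constant_off_finite {β : Type*} [Nonempty β]
    [LocallyFinite G] (hG : G.Preconnected) [Subsingleton G.end] (f : V → β) {K : Set V}
    (hK : K.Finite) (hf : ∀ u v, u ∉ K → v ∉ K → G.Adj u v → f u = f v) :
    ∃ a, {v | f v ≠ a}.Finite := by
  cases finite_or_infinite V
  · exact ⟨Classical.arbitrary β, Set.toFinite _⟩
  lift K to Finset V using hK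
  have hconst (C : G.ComponentCompl K) : ∃ a, ∀ v ∈ C, f v = a := by
    refine ⟨C.lift (fun v _ => f v) fun u v hu hv h => hf u v hu hv h, ?_⟩
    rintro v ⟨hv, rfl⟩
    rfl
  obtain ⟨e, he⟩ := exists_end_mem_ultrafilter hG (hyperfilter V) hyperfilter_le_cofinite
  obtain ⟨a, ha⟩ := hconst (e.1 (.op K))
  refine ⟨a, ?_⟩
  by_contra hinf
  -- An infinite exceptional set carries an ultrafilter of its own, whose end must be `e`.
  have : NeBot (cofinite ⊓ 𝓟 {v | f v ≠ a}) := cofinite_inf_principal_neBot_iff.2 hinf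
  obtain ⟨e', he'⟩ := exists_end_mem_ultrafilter hG (Ultrafilter.of (cofinite ⊓ 𝓟 {v | f v ≠ a}))
    ((Ultrafilter.of_le _).trans inf_le_left)
  have hmem : {v | f v ≠ a} ∈ Ultrafilter.of (cofinite ⊓ 𝓟 {v | f v ≠ a}) :=
    (Ultrafilter.of_le _).trans inf_le_right (mem_principal_self _)
  obtain ⟨v, hv, hva⟩ := Ultrafilter.nonempty_of_mem (inter_mem (he' K) hmem)
  rw [Subsingleton.elim e' e] at hv
  exact hva (ha v hv)

/-- The neighbours of a vertex in the Cayley graph of a finite set form a finite set. -/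
theorem finite_neighborSet_mulCayley {M : Type*} [Group M] {S : Set M} (hS : S.Finite) (u : M) :
    ((mulCayley S).neighborSet u).Finite := by
  refine ((hS.image (u * ·)).union (hS.image (u * ·⁻¹))).subset fun v hv => ?_
  obtain ⟨-, h | h⟩ := (mulCayley_adj S u v).1 hv
  · exact Or.inl ⟨_, h, by simp⟩
  · exact Or.inr ⟨_, h, by simp⟩

/-- The Cayley graph of a generating set is preconnected. -/
theorem preconnected_mulCayley {M : Type*} [Group M] {S : Set M}
    (hS : Subgroup.closure S = ⊤) : (mulCayley S).Preconnected := by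
  have step (u s : M) (hs : s ∈ S) : (mulCayley S).Reachable u (u * s) := by
    by_cases h : u = u * s
    · rw [← h]
    · exact ((mulCayley_adj S _ _).2 ⟨h, Or.inl (by simpa)⟩ : (mulCayley S).Adj _ _).reachable
  have key (g : M) (hg : g ∈ Subgroup.closure S) : ∀ u, (mulCayley S).Reachable u (u * g) := by
    induction hg using Subgroup.closure_induction with
    | mem s hs => exact fun u => step u s hs
    | one => intro u; simp
    | mul x y _ _ hx hy => exact fun u => (hx u).trans (by simpa [mul_assoc] using hy (u * x))
    | inv x _ hx => exact fun u => by simpa using (hx (u * x⁻¹)).symm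
  intro u v
  simpa using key (u⁻¹ * v) (by simp [hS]) u

end SimpleGraph

/-- A function on a group which is invariant under right multiplication by a generating set is
constant. -/
theorem eq_apply_one_of_closure_eq_top {M β : Type*} [Group M] {S : Set M}
    (hS : Subgroup.closure S = ⊤) {f : M → β} (hf : ∀ g, ∀ s ∈ S, f (g * s) = f g) (g : M) :
    f g = f 1 := by
  have key (h : M) (hh : h ∈ Subgroup.closure S) : ∀ u, f (u * h) = f u := by
    induction hh using Subgroup.closure_induction with
    | mem s hs => exact fun u => hf u s hs
    | one => intro u; simp
    | mul x y _ _ hx hy => exact fun u => by rw [← mul_assoc, hy, hx]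
    | inv x _ hx => exact fun u => by simpa using (hx (u * x⁻¹)).symm
  simpa using key g (by simp [hS]) 1

/-- In a finitely generated group with a single end, a function which is invariant under right
multiplication by each generator outside a finite set is constant outside a finite set. -/
theorem exists_finite_ne_of_finite_mul_ne {M β : Type*} [Group M] [Nonempty β] {S : Set M}
    (hfin : S.Finite) (hS : Subgroup.closure S = ⊤) [Subsingleton (SimpleGraph.mulCayley S).end]
    (f : M → β) (hf : ∀ s ∈ S, {g | f (g * s) ≠ f g}.Finite) :
    ∃ a, {g | f g ≠ a}.Finite := by
  have : (SimpleGraph.mulCayley S).LocallyFinite :=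
    fun u => (SimpleGraph.finite_neighborSet_mulCayley hfin u).fintype
  refine SimpleGraph.exists_finite_ne_of_locally_constant_off_finite
    (SimpleGraph.preconnected_mulCayley hS) f (hfin.biUnion hf) fun u v hu hv huv => ?_
  simp only [Set.mem_iUnion, Set.mem_ofPred_eq, not_exists, not_not] at hu hv
  obtain ⟨-, s, hs, rfl | rfl⟩ := (SimpleGraph.mulCayley_adj' S u v).1 huv
  · exact (hu s hs).symm
  · exact hv s hs

theorem proposition2p1 {Γ : Type*} [Group Γ] [Countable Γ] [Infinite Γ]
    (Δ : Subgroup Γ) (hfg : Δ.FG) (hend : HasSingleEnd Δ)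
    (c : Δ → MonoidAlgebra ℤ Γ) (hc : IsOneCocycle Δ c) :
    IsOneCoboundary Δ c := by
  classical
  obtain ⟨S, hfin, hS, hcard⟩ := hend
  have : Subsingleton (SimpleGraph.mulCayley S).end :=
    (Nat.card_eq_one_iff_unique.1 hcard).1
  have hc' (x y : Δ) (g : Γ) :
      (c (x * y)).coeff g = (c x).coeff g + (c y).coeff ((x : Γ)⁻¹ * g) := by
    rw [hc x y]
    simp [MonoidAlgebra.of_apply]
  have hc1 (g : Γ) : (c 1).coeff g = 0 := by
    simpa using hc' 1 1 g
  -- By the cocycle identity this is `-(c x) t`.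
  let f (t : Γ) (x : Δ) : ℤ := (c x⁻¹).coeff ((x : Γ)⁻¹ * t)
  have hf (t : Γ) (x s : Δ) :
      f t (x * s) = (c s⁻¹).coeff ((s : Γ)⁻¹ * ((x : Γ)⁻¹ * t)) + f t x := by
    simp [f, hc', mul_assoc]
  have hfinite (t : Γ) : ∃ a, {x | f t x ≠ a}.Finite := by
    refine exists_finite_ne_of_finite_mul_ne hfin hS (f t) fun s _ => ?_
    refine ((c s⁻¹).coeff.hasFiniteSupport.preimage (f := fun x : Δ => (s : Γ)⁻¹ * ((x : Γ)⁻¹ * t))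
      (fun x _ y _ h => by simpa using h)).subset fun x hx => ?_
    simpa [hf] using hx
  choose a ha using hfinite
  let r (g : Γ) : Γ := (Quotient.mk (QuotientGroup.rightRel Δ) g).out
  have hr (g : Γ) : g * (r g)⁻¹ ∈ Δ :=
    QuotientGroup.rightRel_apply.1 (Quotient.mk_out (s := QuotientGroup.rightRel Δ) g)
  have hr_mul (x : Δ) (g : Γ) : r (x * g) = r g := by
    refine congrArg Quotient.out (Quotient.sound ?_)
    exact QuotientGroup.rightRel_apply.2 (by simp)
  -- Off these cosets `f t` is exactly right-invariant, hence equal to `f t 1 = 0`.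
  let T : Set Γ := ⋃ s ∈ S, r '' (c s⁻¹).coeff.support
  have hT : T.Finite := hfin.biUnion fun s _ => (Finset.finite_toSet _).image r
  have hzero (g : Γ) (hg : r g ∉ T) (x : Δ) : f (r g) x = 0 := by
    have h := eq_apply_one_of_closure_eq_top hS (f := f (r g)) (fun y s hs => ?_) x
    · rw [h]; simp [f, hc1]
    · rw [hf, add_eq_right]
      by_contra hne
      refine hg (Set.mem_biUnion hs ⟨_, Finsupp.mem_support_iff.2 hne, ?_⟩)
      have h1 := hr_mul s⁻¹ ((y : Γ)⁻¹ * r g)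
      have h2 := hr_mul y⁻¹ (r g)
      have h3 := hr_mul ⟨_, hr g⟩ (r g)
      simp only [inv_mul_cancel_right, Subgroup.coe_inv] at h1 h2 h3
      rw [h1, h2, ← h3]
  -- For `g = y t` with `t = r g`, this is the limit of `(c (y * x)) g = (c y) g + (c x) t`, where
  -- `(c x) t` tends to `-a t`. Outside `T` the limit is set to `0`, so the choice of `a` there is
  -- irrelevant.
  let F (g : Γ) : ℤ := (c ⟨g * (r g)⁻¹, hr g⟩).coeff g - if r g ∈ T then a (r g) else 0
  have hF (g : Γ) : F g = f (r g) ⟨g * (r g)⁻¹, hr g⟩⁻¹ - if r g ∈ T then a (r g) else 0 := by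
    simp [F, f]
  have hFfin : (Function.support F).Finite := by
    refine (hT.biUnion fun t _ => (ha t).image fun x : Δ => (x : Γ)⁻¹ * t).subset fun g hg => ?_
    rw [Function.mem_support, hF] at hg
    by_cases h : r g ∈ T
    · rw [if_pos h, sub_ne_zero] at hg
      exact Set.mem_biUnion h ⟨_, hg, by simp⟩
    · rw [if_neg h, hzero g h] at hg
      exact absurd rfl hg
  refine ⟨.ofCoeff (Finsupp.ofSupportFinite F hFfin), fun x => ?_⟩
  ext g
  have hx := hr_mul x⁻¹ g
  have hy : (⟨g * (r g)⁻¹, hr g⟩ : Δ) = x * ⟨(x : Γ)⁻¹ * g * (r ((x : Γ)⁻¹ * g))⁻¹, hr _⟩ := by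
    ext
    simp only [Subgroup.coe_inv] at hx
    simp [hx, mul_assoc]
  have h : F g - F ((x : Γ)⁻¹ * g) = (c x).coeff g := by
    simp only [Subgroup.coe_inv] at hx
    simp only [F, hy, hc']
    simp only [hx]
    ring
  have hb (g : Γ) : Finsupp.ofSupportFinite F hFfin g = F g := rfl
  simpa [MonoidAlgebra.of_apply, hb] using h.symm
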